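/- Let $\mathcal{A}$ be a Banach algebra (over $\mathbb{R}$ or $\mathbb{C}$, not necessarily unital) with a two-sided bounded approximate identity, and let $X$ be a Banach $\mathcal{A}$-bimodule; its dual $X^*$ is a Banach $\mathcal{A}$-bimodule via $\langle x, a\cdot\varphi\rangle=\langle x\cdot a,\varphi\rangle$ and $\langle x,\varphi\cdot a\rangle=\langle a\cdot x,\varphi\rangle$. For a Banach $\mathcal{A}$-bimodule $Y$ let $\mathcal{BL}^n(\mathcal{A},Y)$ be the space of bounded $n$-linear maps $\mathcal{A}^n\to Y$ (with $\mathcal{BL}^0(\mathcal{A},Y)=Y$), and let $\delta^n:\mathcal{BL}^n(\mathcal{A},Y)\to\mathcal{BL}^{n+1}(\mathcal{A},Y)$ be the Hochschild coboundary operator $$(\delta^nT)(a_1,\dots,a_{n+1})=a_1\cdot T(a_2,\dots,a_{n+1})+\sum_{k=1}^n(-1)^kT(a_1,\dots,a_ka_{k+1},\dots,a_{n+1})+(-1)^{n+1}T(a_1,\dots,a_n)\cdot a_{n+1}.$$ For $n\ge 1$ the $n$-th approximate Hochschild cohomology is $$\mathcal{H}^n_{app}(\mathcal{A},Y)=\ker\delta^n\big/\,\overline{\operatorname{ran}\delta^{n-1}},$$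 where the closure is taken in the strong topology, i.e. the topology of pointwise norm convergence on $\mathcal{A}^n$. Put $X_1=\{a\cdot x\cdot b: a,b\in\mathcal{A},\ x\in X\}$. Then $X_1$ is a closed linear subspace of $X$, it is a sub-$\mathcal{A}$-bimodule, and it is neo-unital: every $x\in X_1$ can be written as $x=a\cdot y\cdot b$ with $a,b\in\mathcal{A}$ and $y\in X_1$. The annihilator $X_1^\perp=\{\varphi\in X^*:\varphi|_{X_1}=0\}$ is complemented in $X^*$, i.e. it is the range of a bounded linear projection on $X^*$. Moreover, for every $n\ge 1$, the restriction map $X^*\to X_1^*$ induces a linear isomorphism $$\mathcal{H}^n_{app}(\mathcal{A},X^*)\cong\mathcal{H}^n_{app}(\mathcal{A},X_1^*).$$ -/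

import Mathlib

open scoped Topology

noncomputable section

/-- A two-sided bounded approximate identity: a proper filter `l` on `A` (equivalently, a net),
bounded in norm, along which `a * e → a` and `e * a → a` for every `a`. -/
def HasBoundedApproximateIdentity (A : Type*) [NonUnitalNormedRing A] : Prop :=
  ∃ l : Filter A, l.IsApproximateUnit ∧ ∃ C : ℝ, ∀ᶠ e in l, ‖e‖ ≤ C

/-- The structure of an `A`-bimodule on a normed space `X`, with jointly bounded bilinear actions
`lact a x = a · x` and `ract a x = x · a`. When `X` is complete this is a Banach `A`-bimodule. -/
structure BanachBimodule (𝕜 A X : Type*) [RCLike 𝕜] [NonUnitalNormedRing A] [NormedSpace 𝕜 A]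
    [NormedAddCommGroup X] [NormedSpace 𝕜 X] where
  lact : A →L[𝕜] X →L[𝕜] X
  ract : A →L[𝕜] X →L[𝕜] X
  lact_mul : ∀ a b x, lact (a * b) x = lact a (lact b x)
  ract_mul : ∀ a b x, ract (a * b) x = ract b (ract a x)
  lact_ract : ∀ a b x, lact a (ract b x) = ract b (lact a x)

namespace BanachBimodule

section Basic

variable {𝕜 A X : Type*} [RCLike 𝕜] [NonUnitalNormedRing A] [NormedSpace 𝕜 A]
  [NormedAddCommGroup X] [NormedSpace 𝕜 X]

/-- The dual bimodule: `⟨x, a · φ⟩ = ⟨x · a, φ⟩` and `⟨x, φ · a⟩ = ⟨a · x, φ⟩`. -/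
def dual (M : BanachBimodule 𝕜 A X) : BanachBimodule 𝕜 A (StrongDual 𝕜 X) where
  lact := (ContinuousLinearMap.compL 𝕜 X X 𝕜).flip ∘L M.ract
  ract := (ContinuousLinearMap.compL 𝕜 X X 𝕜).flip ∘L M.lact
  lact_mul a b φ := by ext x; simp [M.ract_mul]
  ract_mul a b φ := by ext x; simp [M.lact_mul]
  lact_ract a b φ := by ext x; simp [M.lact_ract]

@[simp]
theorem dual_lact_apply (M : BanachBimodule 𝕜 A X) (a : A) (φ : StrongDual 𝕜 X) (x : X) :
    M.dual.lact a φ x = φ (M.ract a x) := rfl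

@[simp]
theorem dual_ract_apply (M : BanachBimodule 𝕜 A X) (a : A) (φ : StrongDual 𝕜 X) (x : X) :
    M.dual.ract a φ x = φ (M.lact a x) := rfl

/-- Every element is of the form `a · y · b`. -/
def IsNeoUnital (M : BanachBimodule 𝕜 A X) : Prop :=
  ∀ x : X, ∃ (a b : A) (y : X), x = M.ract b (M.lact a y)

/-- The set `{a · x · b : a, b ∈ A, x ∈ X}`. -/
def productSet (M : BanachBimodule 𝕜 A X) : Set X :=
  {y | ∃ (a b : A) (x : X), y = M.ract b (M.lact a x)}

/-- A linear subspace stable under both actions of `A`. -/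
structure SubBimodule (M : BanachBimodule 𝕜 A X) extends Submodule 𝕜 X where
  lact_mem : ∀ (a : A) {x : X}, x ∈ toSubmodule → M.lact a x ∈ toSubmodule
  ract_mem : ∀ (a : A) {x : X}, x ∈ toSubmodule → M.ract a x ∈ toSubmodule

/-- The restriction of a family of operators `A → BL(X)` leaving `Y` invariant to `A → BL(Y)`. -/
def restrictAct (f : A →L[𝕜] X →L[𝕜] X) (Y : Submodule 𝕜 X)
    (h : ∀ (a : A) {x : X}, x ∈ Y → f a x ∈ Y) : A →L[𝕜] Y →L[𝕜] Y :=
  LinearMap.mkContinuous₂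
    (LinearMap.mk₂ 𝕜 (fun (a : A) (y : Y) => (⟨f a y, h a y.2⟩ : Y))
      (fun a b y => by ext; simp) (fun c a y => by ext; simp)
      (fun a y z => by ext; simp) (fun c a y => by ext; simp))
    ‖f‖ (fun a y => f.le_opNorm₂ a (y : X))

@[simp]
theorem coe_restrictAct (f : A →L[𝕜] X →L[𝕜] X) (Y : Submodule 𝕜 X)
    (h : ∀ (a : A) {x : X}, x ∈ Y → f a x ∈ Y) (a : A) (y : Y) :
    (restrictAct f Y h a y : X) = f a y := rfl

/-- The bimodule structure that a sub-bimodule inherits. -/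
def SubBimodule.toBanachBimodule {M : BanachBimodule 𝕜 A X} (Y : M.SubBimodule) :
    BanachBimodule 𝕜 A Y.toSubmodule where
  lact := restrictAct M.lact Y.toSubmodule Y.lact_mem
  ract := restrictAct M.ract Y.toSubmodule Y.ract_mem
  lact_mul a b x := by ext; simp [M.lact_mul]
  ract_mul a b x := by ext; simp [M.ract_mul]
  lact_ract a b x := by ext; simp [M.lact_ract]

/-- The annihilator `Y^⊥ = {φ ∈ X* : φ = 0 on Y}`. -/
def annihilator (Y : Submodule 𝕜 X) : Submodule 𝕜 (StrongDual 𝕜 X) where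
  carrier := {φ | ∀ y ∈ Y, φ y = 0}
  add_mem' hφ hψ y hy := by simp [hφ y hy, hψ y hy]
  zero_mem' y _ := rfl
  smul_mem' c φ hφ y hy := by simp [hφ y hy]

/-- The restriction map `X* → Y*`. -/
def restrictDual (Y : Submodule 𝕜 X) : StrongDual 𝕜 X →L[𝕜] StrongDual 𝕜 Y :=
  (ContinuousLinearMap.compL 𝕜 Y X 𝕜).flip Y.subtypeL

@[simp]
theorem restrictDual_apply (Y : Submodule 𝕜 X) (φ : StrongDual 𝕜 X) (y : Y) :
    restrictDual Y φ y = φ y := rfl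

end Basic

section Cochains

variable {𝕜 A X Y : Type*} [RCLike 𝕜] [NonUnitalNormedRing A] [NormedSpace 𝕜 A]
  [NormedAddCommGroup X] [NormedSpace 𝕜 X] [NormedAddCommGroup Y] [NormedSpace 𝕜 Y]

variable (𝕜 A X) in
/-- The strong topology on `BLⁿ(A, X)`: `T_i → T` iff `‖(T_i - T)(a₁, …, aₙ)‖ → 0` for all
`a₁, …, aₙ`. -/
abbrev strongTopology (n : ℕ) : TopologicalSpace (A [×n]→L[𝕜] X) :=
  TopologicalSpace.induced (fun T => (T : (Fin n → A) → X)) Pi.topologicalSpace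

theorem mem_closure_strongTopology {n : ℕ} (S : Set (A [×n]→L[𝕜] X)) (T : A [×n]→L[𝕜] X) :
    T ∈ closure[strongTopology 𝕜 A X n] S ↔
      (T : (Fin n → A) → X) ∈ closure ((fun T : A [×n]→L[𝕜] X => (T : (Fin n → A) → X)) '' S) :=
  closure_induced

/-- The closure of a subspace of `BLⁿ(A, X)` in the strong topology. -/
def strongClosure {n : ℕ} (S : Submodule 𝕜 (A [×n]→L[𝕜] X)) :
    Submodule 𝕜 (A [×n]→L[𝕜] X) where
  carrier := closure[strongTopology 𝕜 A X n] (S : Set (A [×n]→L[𝕜] X))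
  add_mem' {T U} hT hU := by
    rw [mem_closure_strongTopology] at hT hU ⊢
    refine map_mem_closure₂ (f := fun u v : (Fin n → A) → X => u + v) continuous_add hT hU ?_
    rintro _ ⟨T', hT', rfl⟩ _ ⟨U', hU', rfl⟩
    exact ⟨T' + U', S.add_mem hT' hU', rfl⟩
  zero_mem' := by
    rw [mem_closure_strongTopology]
    exact subset_closure ⟨0, S.zero_mem, rfl⟩
  smul_mem' c T hT := by
    rw [mem_closure_strongTopology] at hT ⊢
    refine map_mem_closure (f := fun u : (Fin n → A) → X => c • u) (continuous_const_smul c) hT ?_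
    rintro _ ⟨T', hT', rfl⟩
    exact ⟨c • T', S.smul_mem c hT', rfl⟩

/-- Bounded bimodule homomorphisms. -/
structure IsBimoduleHom (M : BanachBimodule 𝕜 A X) (N : BanachBimodule 𝕜 A Y) (f : X →L[𝕜] Y) : Prop where
  map_lact : ∀ a x, f (M.lact a x) = N.lact a (f x)
  map_ract : ∀ a x, f (M.ract a x) = N.ract a (f x)

variable (A) in
/-- The map `BLⁿ(A, X) → BLⁿ(A, Y)`, `T ↦ f ∘ T`. -/
def cochainMap (f : X →L[𝕜] Y) (n : ℕ) : (A [×n]→L[𝕜] X) →ₗ[𝕜] (A [×n]→L[𝕜] Y) where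
  toFun T := f.compContinuousMultilinearMap T
  map_add' S T := by ext; simp
  map_smul' c T := by ext; simp

theorem cochainMap_apply (f : X →L[𝕜] Y) (n : ℕ) (T : A [×n]→L[𝕜] X) (a : Fin n → A) :
    cochainMap A f n T a = f (T a) := rfl

end Cochains

section Hochschild

variable {𝕜 A X : Type*} [RCLike 𝕜] [NonUnitalNormedRing A] [NormedSpace 𝕜 A]
  [IsScalarTower 𝕜 A A] [SMulCommClass 𝕜 A A]
  [NormedAddCommGroup X] [NormedSpace 𝕜 X]

variable (𝕜) in
/-- Changing one entry of a tuple changes one entry of the contracted tuple, linearly. -/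
theorem contractNth_update {n : ℕ} (k : Fin n) (a : Fin (n + 1) → A) (i : Fin (n + 1)) :
    ∃ (j : Fin n) (L : A →ₗ[𝕜] A), ∀ x : A,
      k.castSucc.contractNth (· * ·) (Function.update a i x) =
        Function.update (k.castSucc.contractNth (· * ·) a) j (L x) := by
  rcases lt_trichotomy (i : ℕ) (k : ℕ) with h | h | h
  · refine ⟨⟨i, by omega⟩, LinearMap.id, fun x => ?_⟩
    ext l
    simp only [Fin.contractNth, Function.update_apply, Fin.ext_iff, Fin.val_castSucc, Fin.val_succ,
      LinearMap.id_apply]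
    grind
  · refine ⟨k, LinearMap.mulRight 𝕜 (a k.succ), fun x => ?_⟩
    ext l
    simp only [Fin.contractNth, Function.update_apply, Fin.ext_iff, Fin.val_castSucc, Fin.val_succ,
      LinearMap.mulRight_apply]
    grind
  · by_cases h' : (i : ℕ) = k + 1
    · refine ⟨k, LinearMap.mulLeft 𝕜 (a k.castSucc), fun x => ?_⟩
      ext l
      simp only [Fin.contractNth, Function.update_apply, Fin.ext_iff, Fin.val_castSucc,
        Fin.val_succ, LinearMap.mulLeft_apply]
      grind
    · refine ⟨⟨i - 1, by omega⟩, LinearMap.id, fun x => ?_⟩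
      ext l
      simp only [Fin.contractNth, Function.update_apply, Fin.ext_iff, Fin.val_castSucc,
        Fin.val_succ, LinearMap.id_apply]
      grind

/-- For `k = 0, …, n - 1`, the map `(a₀, …, aₙ) ↦ T(a₀, …, a_k a_{k+1}, …, aₙ)`. -/
def contractArg {n : ℕ} (k : Fin n) (T : A [×n]→L[𝕜] X) : A [×(n + 1)]→L[𝕜] X where
  toFun a := T (k.castSucc.contractNth (· * ·) a)
  map_update_add' {inst} a i x y := by
    obtain rfl : inst = instDecidableEqFin (n + 1) := Subsingleton.elim _ _
    obtain ⟨j, L, h⟩ := contractNth_update 𝕜 k a i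
    simp [h]
  map_update_smul' {inst} a i c x := by
    obtain rfl : inst = instDecidableEqFin (n + 1) := Subsingleton.elim _ _
    obtain ⟨j, L, h⟩ := contractNth_update 𝕜 k a i
    simp [h]
  cont := by
    refine T.cont.comp (continuous_pi fun l => ?_)
    simp only [Fin.contractNth]
    split_ifs <;> fun_prop

@[simp]
theorem contractArg_apply {n : ℕ} (k : Fin n) (T : A [×n]→L[𝕜] X) (a : Fin (n + 1) → A) :
    contractArg k T a = T (k.castSucc.contractNth (· * ·) a) := rfl

/-- The value of `δⁿ` on a single cochain. -/
def coboundaryFun (M : BanachBimodule 𝕜 A X) (n : ℕ) (T : A [×n]→L[𝕜] X) :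
    A [×(n + 1)]→L[𝕜] X :=
  ContinuousLinearMap.uncurryLeft
      ((ContinuousLinearMap.compContinuousMultilinearMapL 𝕜 (fun _ : Fin n => A) X X).flip T
        ∘L M.lact)
    + ∑ k : Fin n, (-1 : 𝕜) ^ ((k : ℕ) + 1) • contractArg k T
    + (-1 : 𝕜) ^ (n + 1) •
      ContinuousMultilinearMap.uncurryRight (M.ract.flip.compContinuousMultilinearMap T)

/-- The Hochschild coboundary formula, with arguments numbered from `0`: `Fin.tail a` is
`(a₁, …, aₙ)` and `Fin.init a` is `(a₀, …, aₙ₋₁)`. -/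
theorem coboundaryFun_apply (M : BanachBimodule 𝕜 A X) (n : ℕ) (T : A [×n]→L[𝕜] X)
    (a : Fin (n + 1) → A) :
    M.coboundaryFun n T a = M.lact (a 0) (T (Fin.tail a))
      + ∑ k : Fin n, (-1 : 𝕜) ^ ((k : ℕ) + 1) • T (k.castSucc.contractNth (· * ·) a)
      + (-1 : 𝕜) ^ (n + 1) • M.ract (a (Fin.last n)) (T (Fin.init a)) := by
  simp [coboundaryFun]

/-- The Hochschild coboundary operator `δⁿ : BLⁿ(A, X) → BLⁿ⁺¹(A, X)`. -/
def coboundary (M : BanachBimodule 𝕜 A X) (n : ℕ) :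
    (A [×n]→L[𝕜] X) →ₗ[𝕜] (A [×(n + 1)]→L[𝕜] X) where
  toFun := M.coboundaryFun n
  map_add' S T := by
    ext a
    simp only [coboundaryFun_apply, add_apply, map_add, smul_add,
      Finset.sum_add_distrib]
    abel
  map_smul' c T := by
    ext a
    simp only [coboundaryFun_apply, smul_apply, map_smul, smul_add,
      Finset.smul_sum, RingHom.id_apply, smul_comm c]

theorem coboundary_apply (M : BanachBimodule 𝕜 A X) (n : ℕ) (T : A [×n]→L[𝕜] X)
    (a : Fin (n + 1) → A) :
    M.coboundary n T a = M.lact (a 0) (T (Fin.tail a))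
      + ∑ k : Fin n, (-1 : 𝕜) ^ ((k : ℕ) + 1) • T (k.castSucc.contractNth (· * ·) a)
      + (-1 : 𝕜) ^ (n + 1) • M.ract (a (Fin.last n)) (T (Fin.init a)) :=
  M.coboundaryFun_apply n T a

/-- The `n`-cocycles `Zⁿ(A, X) = ker δⁿ`. -/
def cocycles (M : BanachBimodule 𝕜 A X) (n : ℕ) : Submodule 𝕜 (A [×n]→L[𝕜] X) :=
  LinearMap.ker (M.coboundary n)

/-- The `n`-coboundaries `Bⁿ(A, X) = ran δⁿ⁻¹` (and `0` for `n = 0`). -/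
def coboundaries (M : BanachBimodule 𝕜 A X) : (n : ℕ) → Submodule 𝕜 (A [×n]→L[𝕜] X)
  | 0 => ⊥
  | n + 1 => LinearMap.range (M.coboundary n)

/-- The approximate Hochschild cohomology `Zⁿ(A, X) / closure of Bⁿ(A, X)`. -/
abbrev ApproxCohomology (M : BanachBimodule 𝕜 A X) (n : ℕ) : Type _ :=
  M.cocycles n ⧸ (strongClosure (M.coboundaries n)).submoduleOf (M.cocycles n)

variable {Y : Type*} [NormedAddCommGroup Y] [NormedSpace 𝕜 Y]
  {M : BanachBimodule 𝕜 A X} {N : BanachBimodule 𝕜 A Y} {f : X →L[𝕜] Y}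

theorem IsBimoduleHom.coboundary_cochainMap (hf : IsBimoduleHom M N f) (n : ℕ)
    (T : A [×n]→L[𝕜] X) :
    N.coboundary n (cochainMap A f n T) = cochainMap A f (n + 1) (M.coboundary n T) := by
  ext a
  simp [coboundary_apply, cochainMap_apply, hf.map_lact, hf.map_ract]

theorem IsBimoduleHom.cochainMap_mem_cocycles (hf : IsBimoduleHom M N f) (n : ℕ) :
    ∀ T ∈ M.cocycles n, cochainMap A f n T ∈ N.cocycles n := by
  intro T hT
  rw [cocycles, LinearMap.mem_ker] at hT ⊢
  rw [hf.coboundary_cochainMap, hT, map_zero]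

theorem IsBimoduleHom.cochainMap_mem_coboundaries (hf : IsBimoduleHom M N f) (n : ℕ)
    (T : A [×n]→L[𝕜] X) (hT : T ∈ M.coboundaries n) :
    cochainMap A f n T ∈ N.coboundaries n := by
  cases n with
  | zero =>
    obtain rfl : T = 0 := hT
    rw [map_zero]
    exact Submodule.zero_mem _
  | succ n =>
    obtain ⟨S, rfl⟩ := hT
    exact ⟨cochainMap A f n S, hf.coboundary_cochainMap n S⟩

theorem IsBimoduleHom.cochainMap_mem_strongClosure (hf : IsBimoduleHom M N f) (n : ℕ)
    (T : A [×n]→L[𝕜] X) (hT : T ∈ strongClosure (M.coboundaries n)) :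
    cochainMap A f n T ∈ strongClosure (N.coboundaries n) := by
  have hT' := (mem_closure_strongTopology _ _).1 hT
  refine (mem_closure_strongTopology _ _).2 ?_
  have hc : Continuous fun (u : (Fin n → A) → X) (a : Fin n → A) => f (u a) := by fun_prop
  refine map_mem_closure (f := fun (u : (Fin n → A) → X) (a : Fin n → A) => f (u a)) hc hT' ?_
  rintro _ ⟨U, hU, rfl⟩
  exact ⟨cochainMap A f n U, hf.cochainMap_mem_coboundaries n U hU, rfl⟩

/-- The map on approximate cohomology induced by a bounded bimodule homomorphism:
`[T] ↦ [f ∘ T]`. -/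
def ApproxCohomology.map (hf : IsBimoduleHom M N f) (n : ℕ) :
    M.ApproxCohomology n →ₗ[𝕜] N.ApproxCohomology n :=
  Submodule.mapQ _ _
    ((cochainMap A f n).restrict (hf.cochainMap_mem_cocycles n))
    (fun T hT => hf.cochainMap_mem_strongClosure n T hT)

end Hochschild

section RestrictHom

variable {𝕜 A X : Type*} [RCLike 𝕜] [NonUnitalNormedRing A] [NormedSpace 𝕜 A]
  [NormedAddCommGroup X] [NormedSpace 𝕜 X]

/-- Restriction `X* → Y*` to a sub-bimodule `Y` is a bimodule homomorphism. -/
theorem SubBimodule.isBimoduleHom_restrictDual {M : BanachBimodule 𝕜 A X} (Y : M.SubBimodule) :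
    IsBimoduleHom M.dual Y.toBanachBimodule.dual (restrictDual Y.toSubmodule) where
  map_lact _ _ := rfl
  map_ract _ _ := rfl

end RestrictHom

end BanachBimodule

end

/-!
For a bounded approximate identity `(e)` of `A`, Cohen's factorization theorem, applied once on each
side, identifies `X₁` with the closed sub-bimodule `{x : e · x → x and x · e → x}`.

Let `Λ ∈ A**` be a weak-* cluster point of `(e)`. As `A` acts on `X*`, so does `Λ`, and
`φ ↦ Λ · φ · Λ` is a bimodule homomorphism of `X*` which vanishes on `X₁^⊥` and does not change the
restriction of `φ` to `X₁`. It therefore factors through a right inverse `s : X₁* → X*` of the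
restriction map, and the kernel `X₁^⊥` of the latter is complemented.

On cocycles, `T ↦ Λ · T · Λ` differs from the identity by coboundaries: `T - Λ · T` is annihilated
by the left action of `A`, `T - T · Λ` by the right action, and such a cocycle is, up to sign, the
coboundary of its value at `Λ` in the first, respectively last, argument. Hence restriction and `s`
induce mutually inverse maps on cohomology, even before taking closures.
-/

open Filter

noncomputable section

section CohenFactorization

instance {𝕜 X : Type*} [NontriviallyNormedField 𝕜] [NormedAddCommGroup X] [NormedSpace 𝕜 X] :
    IsBoundedSMul (X →L[𝕜] X) X :=
  .of_norm_smul_le fun f x => f.le_opNorm x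

theorem exists_norm_one_sub_lt_one_and_norm_mul_le (𝕜 : Type*) [RCLike 𝕜] {C : ℝ} (hC : 0 ≤ C) :
    ∃ c : 𝕜, ‖1 - c‖ < 1 ∧ ‖c‖ * C ≤ 1 / 2 := by
  set r : ℝ := 1 / (2 * (C + 1)) with hr
  have hr₀ : 0 < r := by positivity
  have hr₁ : r ≤ 1 / 2 := by
    rw [hr]
    gcongr
    linarith
  refine ⟨(r : 𝕜), ?_, ?_⟩
  · rw [← RCLike.ofReal_one, ← RCLike.ofReal_sub, RCLike.norm_ofReal, abs_lt]
    constructor <;> linarith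
  · rw [RCLike.norm_ofReal, abs_of_pos hr₀, hr, div_mul_eq_mul_div, div_le_div_iff₀] <;> linarith

variable {B X : Type*} [NormedRing B] [NormedAddCommGroup X] [Module B X]

theorem ringInverse_one_sub_smul_sub_self {t : B} (ht : IsUnit (1 - t)) (x : X) :
    Ring.inverse (1 - t) • x - x = Ring.inverse (1 - t) • t • x := by
  have hx : Ring.inverse (1 - t) • (1 - t) • x = x := by
    rw [smul_smul, Ring.inverse_mul_cancel _ ht, one_smul]
  rw [sub_smul, one_smul, smul_sub] at hx
  rw [sub_eq_iff_eq_add', ← sub_eq_iff_eq_add, hx]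

section ScalarAdd

variable {𝕜 A : Type*} [NontriviallyNormedField 𝕜] [NormedAlgebra 𝕜 B]
  [NormedAddCommGroup A] [NormedSpace 𝕜 A]

/-- The element `r + L q`, the image of `(r, q)` under the unital extension of `L` to the
unitization `𝕜 ⊕ A`. Cohen's argument moves all the mass of an invertible element of this form from
the scalar part `r` to the part `q`. -/
def scalarAdd (L : A →L[𝕜] B) (r : 𝕜) (q : A) : B := r • 1 + L q

theorem scalarAdd_eq_one_sub_mul (L : A →L[𝕜] B) (r c : 𝕜) (q e : A)
    (he : IsUnit (1 - c • (1 - L e))) :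
    scalarAdd L (r * (1 - c)) (q + (r * c) • e) =
      (1 - c • (1 - L e)) * (r • 1 + Ring.inverse (1 - c • (1 - L e)) * L q) := by
  rw [mul_add, Ring.mul_inverse_cancel_left _ _ he, mul_smul_comm, mul_one, scalarAdd, map_add,
    map_smul]
  module

variable [CompleteSpace B]

theorem norm_ringInverse_one_sub_le {t : B} (ht : ‖t‖ ≤ 1 / 2) :
    ‖Ring.inverse (1 - t)‖ ≤ ‖(1 : B)‖ + 1 := by
  have ht₁ : ‖t‖ < 1 := by linarith
  have hinv : (1 - ‖t‖)⁻¹ ≤ 2 := inv_le_of_inv_le₀ two_pos (by linarith)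
  calc ‖Ring.inverse (1 - t)‖ = ‖∑' n : ℕ, t ^ n‖ := by
        rw [NormedRing.inverse_one_sub t ht₁]
        rfl
    _ ≤ ‖(1 : B)‖ - 1 + (1 - ‖t‖)⁻¹ := tsum_geometric_le_of_norm_lt_one t ht₁
    _ ≤ ‖(1 : B)‖ + 1 := by linarith

theorem isUnit_one_sub_of_norm_le_half {t : B} (ht : ‖t‖ ≤ 1 / 2) : IsUnit (1 - t) :=
  isUnit_one_sub_of_norm_lt_one (by linarith)

variable [IsBoundedSMul B X]

theorem tendsto_ringInverse_one_sub_smul {ι : Type*} {l : Filter ι} {t : ι → B} {x : X}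
    (ht : ∀ᶠ i in l, ‖t i‖ ≤ 1 / 2) (hx : Tendsto (fun i => t i • x) l (𝓝 0)) :
    Tendsto (fun i => Ring.inverse (1 - t i) • x) l (𝓝 x) := by
  rw [tendsto_iff_norm_sub_tendsto_zero]
  have hbound : Tendsto (fun i => (‖(1 : B)‖ + 1) * ‖t i • x‖) l (𝓝 0) := by
    simpa using hx.norm.const_mul (‖(1 : B)‖ + 1)
  refine squeeze_zero' (.of_forall fun _ => norm_nonneg _) ?_ hbound
  filter_upwards [ht] with i hi
  rw [ringInverse_one_sub_smul_sub_self (isUnit_one_sub_of_norm_le_half hi)]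
  exact (norm_smul_le _ _).trans (by gcongr; exact norm_ringInverse_one_sub_le hi)

variable {l : Filter A} {L : A →L[𝕜] B} {c : 𝕜} {x : X} {q : A}

theorem tendsto_smul_one_add_ringInverse_mul (hc : ∀ᶠ e in l, ‖c • (1 - L e)‖ ≤ 1 / 2)
    (hq : Tendsto (fun e => L e * L q) l (𝓝 (L q))) (r : 𝕜) :
    Tendsto (fun e => r • 1 + Ring.inverse (1 - c • (1 - L e)) * L q) l
      (𝓝 (scalarAdd L r q)) := by
  refine tendsto_const_nhds.add (tendsto_ringInverse_one_sub_smul hc ?_)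
  simpa [sub_mul] using (hq.const_sub (L q)).const_smul c

theorem eventually_isUnit_scalarAdd (hc : ∀ᶠ e in l, ‖c • (1 - L e)‖ ≤ 1 / 2)
    (hq : Tendsto (fun e => L e * L q) l (𝓝 (L q))) {r : 𝕜} (hu : IsUnit (scalarAdd L r q)) :
    ∀ᶠ e in l, IsUnit (scalarAdd L (r * (1 - c)) (q + (r * c) • e)) := by
  filter_upwards [hc, (tendsto_smul_one_add_ringInverse_mul hc hq r).eventually
    (Units.isOpen.mem_nhds hu)] with e he hue
  have hce := isUnit_one_sub_of_norm_le_half he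
  exact scalarAdd_eq_one_sub_mul L r c q e hce ▸ hce.mul hue

theorem tendsto_ringInverse_scalarAdd_smul
    (hc : ∀ᶠ e in l, ‖c • (1 - L e)‖ ≤ 1 / 2)
    (hq : Tendsto (fun e => L e * L q) l (𝓝 (L q))) (hx : Tendsto (fun e => L e • x) l (𝓝 x))
    {r : 𝕜} (hu : IsUnit (scalarAdd L r q)) :
    Tendsto (fun e => Ring.inverse (scalarAdd L (r * (1 - c)) (q + (r * c) • e)) • x) l
      (𝓝 (Ring.inverse (scalarAdd L r q) • x)) := by
  have hinv : Tendsto (fun e => Ring.inverse (r • 1 + Ring.inverse (1 - c • (1 - L e)) * L q)) l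
      (𝓝 (Ring.inverse (scalarAdd L r q))) := by
    obtain ⟨u, hu⟩ := hu
    have h := tendsto_smul_one_add_ringInverse_mul hc hq r
    rw [← hu] at h ⊢
    exact (NormedRing.inverse_continuousAt u).tendsto.comp h
  have hcx : Tendsto (fun e => (c • (1 - L e)) • x) l (𝓝 0) := by
    have h (e : A) : (c • (1 - L e)) • x = (c • (1 : B)) • (x - L e • x) := by
      rw [← smul_one_mul c (1 - L e), mul_smul, sub_smul, one_smul]
    simpa only [h, sub_self, smul_zero] using (hx.const_sub x).const_smul (c • (1 : B))
  refine (hinv.smul (tendsto_ringInverse_one_sub_smul hc hcx)).congr' ?_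
  filter_upwards [hc] with e he
  have hce := isUnit_one_sub_of_norm_le_half he
  rw [scalarAdd_eq_one_sub_mul L r c q e hce, Ring.inverse_mul (.inl hce), mul_smul]

theorem exists_seq_isUnit_scalarAdd [l.NeBot] {K : ℝ} (hK : ∀ᶠ e in l, ‖e‖ ≤ K)
    (hc : ∀ᶠ e in l, ‖c • (1 - L e)‖ ≤ 1 / 2)
    (hL : ∀ q, Tendsto (fun e => L e * L q) l (𝓝 (L q)))
    (hx : Tendsto (fun e => L e • x) l (𝓝 x)) :
    ∃ q : ℕ → A, ∀ n, IsUnit (scalarAdd L ((1 - c) ^ n) (q n)) ∧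
      dist (q n) (q (n + 1)) ≤ (‖c‖ * K) * ‖1 - c‖ ^ n ∧
      dist (Ring.inverse (scalarAdd L ((1 - c) ^ n) (q n)) • x)
        (Ring.inverse (scalarAdd L ((1 - c) ^ (n + 1)) (q (n + 1))) • x) ≤ 1 * (1 / 2) ^ n := by
  have hstep : ∀ (n : ℕ) (q : A), IsUnit (scalarAdd L ((1 - c) ^ n) q) → ∃ q' : A,
      IsUnit (scalarAdd L ((1 - c) ^ (n + 1)) q') ∧
      dist q q' ≤ (‖c‖ * K) * ‖1 - c‖ ^ n ∧
      dist (Ring.inverse (scalarAdd L ((1 - c) ^ n) q) • x)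
        (Ring.inverse (scalarAdd L ((1 - c) ^ (n + 1)) q') • x) ≤ 1 * (1 / 2) ^ n := by
    intro n q hu
    have hclose := (tendsto_ringInverse_scalarAdd_smul hc (hL q) hx hu).eventually
      (Metric.closedBall_mem_nhds _ (show (0 : ℝ) < 1 * (1 / 2) ^ n by positivity))
    obtain ⟨e, he, hue, hxe : dist _ _ ≤ _⟩ :=
      (hK.and ((eventually_isUnit_scalarAdd hc (hL q) hu).and hclose)).exists
    rw [← pow_succ] at hue hxe
    refine ⟨q + ((1 - c) ^ n * c) • e, hue, ?_, (dist_comm _ _).trans_le hxe⟩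
    calc dist q (q + ((1 - c) ^ n * c) • e) = ‖c‖ * ‖e‖ * ‖1 - c‖ ^ n := by
          rw [dist_self_add_right, norm_smul, norm_mul, norm_pow]
          ring
      _ ≤ (‖c‖ * K) * ‖1 - c‖ ^ n := by gcongr
  choose! next hnext using hstep
  let q : ℕ → A := Nat.rec 0 next
  have hu : ∀ n, IsUnit (scalarAdd L ((1 - c) ^ n) (q n)) := fun n => by
    induction n with
    | zero => simp [scalarAdd, q]
    | succ n ih => exact (hnext n _ ih).1
  exact ⟨q, fun n => ⟨hu n, (hnext n _ (hu n)).2⟩⟩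

end ScalarAdd

theorem exists_eq_smul_of_tendsto {𝕜 A : Type*} [RCLike 𝕜] [NormedAlgebra 𝕜 B]
    [CompleteSpace B] [IsBoundedSMul B X]
    [NormedAddCommGroup A] [NormedSpace 𝕜 A] [CompleteSpace A] [CompleteSpace X]
    {l : Filter A} [l.NeBot] (L : A →L[𝕜] B) {K : ℝ} (hK : ∀ᶠ e in l, ‖e‖ ≤ K)
    (hL : ∀ q, Tendsto (fun e => L e * L q) l (𝓝 (L q)))
    {x : X} (hx : Tendsto (fun e => L e • x) l (𝓝 x)) : ∃ (a : A) (y : X), x = L a • y := by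
  have hK₀ : 0 ≤ K := by
    obtain ⟨e, he⟩ := hK.exists
    exact (norm_nonneg e).trans he
  obtain ⟨c, hc₁, hc⟩ := exists_norm_one_sub_lt_one_and_norm_mul_le 𝕜
    (show 0 ≤ ‖(1 : B)‖ + ‖L‖ * K by positivity)
  have hsmall : ∀ᶠ e in l, ‖c • (1 - L e)‖ ≤ 1 / 2 := by
    filter_upwards [hK] with e he
    calc ‖c • (1 - L e)‖ ≤ ‖c‖ * (‖(1 : B)‖ + ‖L e‖) := by
          rw [norm_smul]
          gcongr
          exact norm_sub_le _ _
      _ ≤ ‖c‖ * (‖(1 : B)‖ + ‖L‖ * K) := by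
          gcongr
          exact L.le_opNorm_of_le he
      _ ≤ 1 / 2 := hc
  obtain ⟨q, hq⟩ := exists_seq_isUnit_scalarAdd hK hsmall hL hx
  obtain ⟨a, ha⟩ := cauchySeq_tendsto_of_complete
    (cauchySeq_of_le_geometric _ _ hc₁ fun n => (hq n).2.1)
  obtain ⟨y, hy⟩ := cauchySeq_tendsto_of_complete
    (cauchySeq_of_le_geometric _ _ one_half_lt_one fun n => (hq n).2.2)
  have hlim : Tendsto (fun n => scalarAdd L ((1 - c) ^ n) (q n)) atTop (𝓝 (L a)) := by
    simpa [scalarAdd] using ((tendsto_pow_atTop_nhds_zero_of_norm_lt_one hc₁).smul_const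
      (1 : B)).add ((L.continuous.tendsto a).comp ha)
  refine ⟨a, y, tendsto_nhds_unique (tendsto_const_nhds.congr fun n => ?_) (hlim.smul hy)⟩
  rw [smul_smul, Ring.mul_inverse_cancel _ (hq n).1, one_smul]

end CohenFactorization

theorem exists_comp_eq_of_ker_le {𝕜 E F G : Type*} [NontriviallyNormedField 𝕜]
    [NormedAddCommGroup E] [NormedSpace 𝕜 E] [CompleteSpace E] [NormedAddCommGroup F]
    [NormedSpace 𝕜 F] [CompleteSpace F] [NormedAddCommGroup G] [NormedSpace 𝕜 G] {f : E →L[𝕜] F}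
    (hf : Function.Surjective f) {g : E →L[𝕜] G} (hfg : f.ker ≤ g.ker) :
    ∃ s : F →L[𝕜] G, s ∘L f = g := by
  obtain ⟨r, hr⟩ := f.toLinearMap.exists_rightInverse_of_surjective (LinearMap.range_eq_top.2 hf)
  have hcomp (x : E) : g (r (f x)) = g x := by
    have hmem : r (f x) - x ∈ f.ker := by
      rw [LinearMap.mem_ker, map_sub, sub_eq_zero]
      exact LinearMap.congr_fun hr (f x)
    exact sub_eq_zero.1 ((map_sub g _ _).symm.trans (hfg hmem))
  have hquot := (f.isOpenMap hf).isQuotientMap f.continuous hf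
  exact ⟨⟨g.toLinearMap ∘ₗ r, hquot.continuous_iff.2 (g.continuous.congr fun x => (hcomp x).symm)⟩,
    ContinuousLinearMap.ext hcomp⟩

namespace BanachBimodule

theorem isClosed_setOf_tendsto_self {𝕜 E X : Type*} [RCLike 𝕜] [NormedAddCommGroup E]
    [NormedSpace 𝕜 E] [NormedAddCommGroup X] [NormedSpace 𝕜 X] {l : Filter E} {K : ℝ}
    (hK : ∀ᶠ e in l, ‖e‖ ≤ K) (f : E →L[𝕜] X →L[𝕜] X) :
    IsClosed {x | Tendsto (fun e => f e x) l (𝓝 x)} := by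
  have hlip (e : {e : E // ‖e‖ ≤ K}) : LipschitzWith (‖f‖₊ * K.toNNReal) (f e) :=
    (f e).lipschitz.weaken <| (f.le_opNNNorm e).trans <| by
      gcongr
      exact NNReal.le_toNNReal_of_coe_le e.2
  have hclosed := (LipschitzWith.uniformEquicontinuous _ _ hlip).equicontinuous
    |>.isClosed_setOfPred_tendsto (l := comap Subtype.val l) continuous_id
  have hrange : Set.range (Subtype.val : {e : E // ‖e‖ ≤ K} → E) ∈ l := by
    rwa [Subtype.range_coe_subtype]
  simpa only [← tendsto_comap'_iff hrange] using! hclosed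

section EssentialPart

variable {𝕜 A X : Type*} [RCLike 𝕜] [NonUnitalNormedRing A] [NormedSpace 𝕜 A]
  [NormedAddCommGroup X] [NormedSpace 𝕜 X] {l : Filter A} {K : ℝ}
  (M : BanachBimodule 𝕜 A X)

theorem tendsto_lact_mul_lact (hl : l.IsApproximateUnit) (a : A) :
    Tendsto (fun e => M.lact e * M.lact a) l (𝓝 (M.lact a)) :=
  ((M.lact.continuous.tendsto a).comp (hl.tendsto_mul_right a)).congr fun e =>
    ContinuousLinearMap.ext fun x => M.lact_mul e a x

theorem tendsto_ract_mul_ract (hl : l.IsApproximateUnit) (a : A) :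
    Tendsto (fun e => M.ract e * M.ract a) l (𝓝 (M.ract a)) :=
  ((M.ract.continuous.tendsto a).comp (hl.tendsto_mul_left a)).congr fun e =>
    ContinuousLinearMap.ext fun x => M.ract_mul a e x

theorem tendsto_lact_lact (hl : l.IsApproximateUnit) (a : A) (x : X) :
    Tendsto (fun e => M.lact e (M.lact a x)) l (𝓝 (M.lact a x)) :=
  (M.tendsto_lact_mul_lact hl a).smul_const x

theorem tendsto_ract_ract (hl : l.IsApproximateUnit) (a : A) (x : X) :
    Tendsto (fun e => M.ract e (M.ract a x)) l (𝓝 (M.ract a x)) :=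
  (M.tendsto_ract_mul_ract hl a).smul_const x

/-- The essential part of a bimodule along an approximate unit: the elements `x` such that
`e · x → x` and `x · e → x`. For a bounded approximate unit it is closed, and it coincides with
`A · X · A` by Cohen factorization. -/
def essentialPart (hl : l.IsApproximateUnit) : M.SubBimodule where
  carrier := {x | Tendsto (fun e => M.lact e x) l (𝓝 x) ∧ Tendsto (fun e => M.ract e x) l (𝓝 x)}
  add_mem' hx hy := by
    simpa only [Set.mem_ofPred_eq, map_add] using ⟨hx.1.add hy.1, hx.2.add hy.2⟩
  zero_mem' := by
    simpa only [Set.mem_ofPred_eq, map_zero] using ⟨tendsto_const_nhds, tendsto_const_nhds⟩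
  smul_mem' c x hx := by
    simpa only [Set.mem_ofPred_eq, map_smul] using ⟨hx.1.const_smul c, hx.2.const_smul c⟩
  lact_mem a x hx := by
    refine ⟨M.tendsto_lact_lact hl a x, ?_⟩
    exact (((M.lact a).continuous.tendsto x).comp hx.2).congr fun e => M.lact_ract a e x
  ract_mem a x hx := by
    refine ⟨?_, M.tendsto_ract_ract hl a x⟩
    exact (((M.ract a).continuous.tendsto x).comp hx.1).congr fun e => (M.lact_ract e a x).symm

theorem isClosed_essentialPart (hl : l.IsApproximateUnit) (hK : ∀ᶠ e in l, ‖e‖ ≤ K) :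
    IsClosed ((M.essentialPart hl).toSubmodule : Set X) :=
  (isClosed_setOf_tendsto_self hK M.lact).inter (isClosed_setOf_tendsto_self hK M.ract)

theorem productSet_subset_essentialPart (hl : l.IsApproximateUnit) :
    M.productSet ⊆ (M.essentialPart hl).toSubmodule := by
  rintro _ ⟨a, b, x, rfl⟩
  refine ⟨?_, M.tendsto_ract_ract hl b _⟩
  simpa only [← M.lact_ract] using M.tendsto_lact_lact hl a (M.ract b x)

variable [CompleteSpace A] [CompleteSpace X]

theorem isNeoUnital_of_tendsto (hl : l.IsApproximateUnit) (hK : ∀ᶠ e in l, ‖e‖ ≤ K)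
    (hleft : ∀ x, Tendsto (fun e => M.lact e x) l (𝓝 x))
    (hright : ∀ x, Tendsto (fun e => M.ract e x) l (𝓝 x)) : M.IsNeoUnital := by
  have := hl.neBot
  intro x
  obtain ⟨b, z, rfl⟩ := exists_eq_smul_of_tendsto M.ract hK (M.tendsto_ract_mul_ract hl) (hright x)
  obtain ⟨a, y, rfl⟩ := exists_eq_smul_of_tendsto M.lact hK (M.tendsto_lact_mul_lact hl) (hleft z)
  exact ⟨a, b, y, rfl⟩

theorem isNeoUnital_essentialPart (hl : l.IsApproximateUnit) (hK : ∀ᶠ e in l, ‖e‖ ≤ K) :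
    (M.essentialPart hl).toBanachBimodule.IsNeoUnital :=
  have := (M.isClosed_essentialPart hl hK).completeSpace_coe
  isNeoUnital_of_tendsto _ hl hK (fun x => tendsto_subtype_rng.2 x.2.1)
    fun x => tendsto_subtype_rng.2 x.2.2

theorem coe_essentialPart (hl : l.IsApproximateUnit) (hK : ∀ᶠ e in l, ‖e‖ ≤ K) :
    ((M.essentialPart hl).toSubmodule : Set X) = M.productSet := by
  refine subset_antisymm (fun x hx => ?_) (M.productSet_subset_essentialPart hl)
  obtain ⟨a, b, y, h⟩ := M.isNeoUnital_essentialPart hl hK ⟨x, hx⟩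
  exact ⟨a, b, y, congrArg Subtype.val h⟩

end EssentialPart

section Hom

variable {𝕜 A X Y Z : Type*} [RCLike 𝕜] [NonUnitalNormedRing A] [NormedSpace 𝕜 A]
  [NormedAddCommGroup X] [NormedSpace 𝕜 X] [NormedAddCommGroup Y] [NormedSpace 𝕜 Y]
  [NormedAddCommGroup Z] [NormedSpace 𝕜 Z] {M : BanachBimodule 𝕜 A X} {N : BanachBimodule 𝕜 A Y}
  {P : BanachBimodule 𝕜 A Z} {f : X →L[𝕜] Y} {g : Y →L[𝕜] Z}

theorem IsBimoduleHom.comp (hg : IsBimoduleHom N P g) (hf : IsBimoduleHom M N f) :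
    IsBimoduleHom M P (g ∘L f) where
  map_lact a x := by simp only [ContinuousLinearMap.comp_apply, hf.map_lact, hg.map_lact]
  map_ract a x := by simp only [ContinuousLinearMap.comp_apply, hf.map_ract, hg.map_ract]

theorem IsBimoduleHom.of_comp_surjective (hgf : IsBimoduleHom M P (g ∘L f))
    (hf : IsBimoduleHom M N f) (hsurj : Function.Surjective f) : IsBimoduleHom N P g where
  map_lact a y := by
    obtain ⟨x, rfl⟩ := hsurj y
    rw [← hf.map_lact]
    exact hgf.map_lact a x
  map_ract a y := by
    obtain ⟨x, rfl⟩ := hsurj y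
    rw [← hf.map_ract]
    exact hgf.map_ract a x

end Hom

section BidualEval

variable {𝕜 E X : Type*} [RCLike 𝕜] [NormedAddCommGroup E] [NormedSpace 𝕜 E]
  [NormedAddCommGroup X] [NormedSpace 𝕜 X]

theorem exists_forall_tendsto_bidual {U : Ultrafilter E} {K : ℝ}
    (hK : ∀ᶠ e in (U : Filter E), ‖e‖ ≤ K) :
    ∃ Λ : StrongDual 𝕜 (StrongDual 𝕜 E), ∀ g : StrongDual 𝕜 E, Tendsto g U (𝓝 (Λ g)) := by
  let j (e : E) : WeakDual 𝕜 (StrongDual 𝕜 E) :=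
    StrongDual.toWeakDual (NormedSpace.inclusionInDoubleDual 𝕜 E e)
  have hball : U.map j ≤ 𝓟 (WeakDual.toStrongDual ⁻¹'
      Metric.closedBall (0 : StrongDual 𝕜 (StrongDual 𝕜 E)) K) := by
    rw [le_principal_iff, Ultrafilter.coe_map, mem_map]
    filter_upwards [hK] with e he
    exact (mem_closedBall_zero_iff (E := StrongDual 𝕜 (StrongDual 𝕜 E))).2
      ((NormedSpace.double_dual_bound 𝕜 E e).trans he)
  obtain ⟨Λ, -, hΛ⟩ := (WeakDual.isCompact_closedBall 0 K).ultrafilter_le_nhds _ hball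
  exact ⟨WeakDual.toStrongDual Λ, fun g => ((WeakDual.eval_continuous g).tendsto Λ).comp hΛ⟩

/-- The weak-* continuous extension to `E**` of an operator `G : E → X*`, evaluated at `Λ`:
`⟨x, bidualEval Λ G⟩ = ⟨⟨x, G(·)⟩, Λ⟩`. -/
def bidualEval (Λ : StrongDual 𝕜 (StrongDual 𝕜 E)) :
    (E →L[𝕜] StrongDual 𝕜 X) →L[𝕜] StrongDual 𝕜 X :=
  ContinuousLinearMap.compL 𝕜 X (StrongDual 𝕜 E) 𝕜 Λ ∘L
    (ContinuousLinearMap.flipₗᵢ 𝕜 E X 𝕜 : (E →L[𝕜] X →L[𝕜] 𝕜) →L[𝕜] X →L[𝕜] E →L[𝕜] 𝕜)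

end BidualEval

section MixedIdentity

variable {𝕜 A X : Type*} [RCLike 𝕜] [NonUnitalNormedRing A] [NormedSpace 𝕜 A]
  [NormedAddCommGroup X] [NormedSpace 𝕜 X] {Λ : StrongDual 𝕜 (StrongDual 𝕜 A)}

theorem bidualEval_dual_lact_comp (Λ : StrongDual 𝕜 (StrongDual 𝕜 A)) (M : BanachBimodule 𝕜 A X)
    (a : A) (G : A →L[𝕜] StrongDual 𝕜 X) :
    bidualEval Λ (M.dual.lact a ∘L G) = M.dual.lact a (bidualEval Λ G) := rfl

theorem bidualEval_dual_ract_comp (Λ : StrongDual 𝕜 (StrongDual 𝕜 A)) (M : BanachBimodule 𝕜 A X)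
    (a : A) (G : A →L[𝕜] StrongDual 𝕜 X) :
    bidualEval Λ (M.dual.ract a ∘L G) = M.dual.ract a (bidualEval Λ G) := rfl

/-- The operator `φ ↦ Λ · φ` on `X*`, where the functional `Λ` on `A*` acts through the weak-*
continuous extension of `a ↦ a · φ`. -/
def lactBidual (Λ : StrongDual 𝕜 (StrongDual 𝕜 A)) (M : BanachBimodule 𝕜 A X) :
    StrongDual 𝕜 X →L[𝕜] StrongDual 𝕜 X :=
  bidualEval Λ ∘L M.dual.lact.flip

/-- The operator `φ ↦ φ · Λ` on `X*`, where the functional `Λ` on `A*` acts through the weak-*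
continuous extension of `a ↦ φ · a`. -/
def ractBidual (Λ : StrongDual 𝕜 (StrongDual 𝕜 A)) (M : BanachBimodule 𝕜 A X) :
    StrongDual 𝕜 X →L[𝕜] StrongDual 𝕜 X :=
  bidualEval Λ ∘L M.dual.ract.flip

/-- The operator `φ ↦ (Λ · φ) · Λ` on `X*`. -/
def bidualCompression (Λ : StrongDual 𝕜 (StrongDual 𝕜 A)) (M : BanachBimodule 𝕜 A X) :
    StrongDual 𝕜 X →L[𝕜] StrongDual 𝕜 X :=
  ractBidual Λ M ∘L lactBidual Λ M

theorem bidualCompression_apply_eq_zero (Λ : StrongDual 𝕜 (StrongDual 𝕜 A))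
    {M : BanachBimodule 𝕜 A X} {φ : StrongDual 𝕜 X} (hφ : ∀ x ∈ M.productSet, φ x = 0) :
    bidualCompression Λ M φ = 0 := by
  have hinner (a : A) (x : X) : M.dual.ract a (lactBidual Λ M φ) x = 0 := by
    have hzero : (M.dual.lact.flip φ).flip (M.lact a x) = 0 := by
      ext b
      exact hφ _ ⟨a, b, x, rfl⟩
    exact (congrArg Λ hzero).trans (map_zero Λ)
  ext x
  have hzero : (M.dual.ract.flip (lactBidual Λ M φ)).flip x = 0 := by
    ext a
    exact hinner a x
  exact (congrArg Λ hzero).trans (map_zero Λ)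

variable [IsScalarTower 𝕜 A A] [SMulCommClass 𝕜 A A] {M : BanachBimodule 𝕜 A X}

/-- A mixed identity of `A**`: a functional `Λ` on `A*` which acts as the identity on the
functionals `b ↦ g (a * b)` and `b ↦ g (b * a)`. Equivalently, `a * Λ = a = Λ * a` for the module
actions of `A` on `A**`. -/
structure IsMixedIdentity (Λ : StrongDual 𝕜 (StrongDual 𝕜 A)) : Prop where
  apply_comp_mul_left (a : A) (g : StrongDual 𝕜 A) : Λ (g ∘L ContinuousLinearMap.mul 𝕜 A a) = g a
  apply_comp_mul_right (a : A) (g : StrongDual 𝕜 A) :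
    Λ (g ∘L (ContinuousLinearMap.mul 𝕜 A).flip a) = g a

variable (𝕜) in
theorem exists_isMixedIdentity {l : Filter A} (hl : l.IsApproximateUnit) {K : ℝ}
    (hK : ∀ᶠ e in l, ‖e‖ ≤ K) : ∃ Λ : StrongDual 𝕜 (StrongDual 𝕜 A), IsMixedIdentity Λ := by
  have := hl.neBot
  have hle := Ultrafilter.of_le l
  obtain ⟨Λ, hΛ⟩ := exists_forall_tendsto_bidual (𝕜 := 𝕜) (hK.filter_mono hle)
  exact ⟨Λ,
    fun a g => tendsto_nhds_unique (hΛ _)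
      ((g.continuous.tendsto a).comp ((hl.tendsto_mul_left a).mono_left hle)),
    fun a g => tendsto_nhds_unique (hΛ _)
      ((g.continuous.tendsto a).comp ((hl.tendsto_mul_right a).mono_left hle))⟩

namespace IsMixedIdentity

theorem bidualEval_comp_mul_left (h : IsMixedIdentity Λ) (a : A) (G : A →L[𝕜] StrongDual 𝕜 X) :
    bidualEval Λ (G ∘L ContinuousLinearMap.mul 𝕜 A a) = G a := by
  ext x
  exact h.apply_comp_mul_left a (G.flip x)

theorem bidualEval_comp_mul_right (h : IsMixedIdentity Λ) (a : A) (G : A →L[𝕜] StrongDual 𝕜 X) :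
    bidualEval Λ (G ∘L (ContinuousLinearMap.mul 𝕜 A).flip a) = G a := by
  ext x
  exact h.apply_comp_mul_right a (G.flip x)

theorem lactBidual_dual_lact (h : IsMixedIdentity Λ) (a : A) (φ : StrongDual 𝕜 X) :
    lactBidual Λ M (M.dual.lact a φ) = M.dual.lact a φ := by
  have hG : M.dual.lact.flip (M.dual.lact a φ) =
      M.dual.lact.flip φ ∘L (ContinuousLinearMap.mul 𝕜 A).flip a := by
    ext b : 1
    exact (M.dual.lact_mul b a φ).symm
  exact (congrArg (bidualEval Λ) hG).trans (h.bidualEval_comp_mul_right a _)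

theorem ractBidual_dual_ract (h : IsMixedIdentity Λ) (a : A) (φ : StrongDual 𝕜 X) :
    ractBidual Λ M (M.dual.ract a φ) = M.dual.ract a φ := by
  have hG : M.dual.ract.flip (M.dual.ract a φ) =
      M.dual.ract.flip φ ∘L ContinuousLinearMap.mul 𝕜 A a := by
    ext b : 1
    exact (M.dual.ract_mul a b φ).symm
  exact (congrArg (bidualEval Λ) hG).trans (h.bidualEval_comp_mul_left a _)

theorem dual_lact_lactBidual (h : IsMixedIdentity Λ) (a : A) (φ : StrongDual 𝕜 X) :
    M.dual.lact a (lactBidual Λ M φ) = M.dual.lact a φ := by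
  have hG : M.dual.lact a ∘L M.dual.lact.flip φ =
      M.dual.lact.flip φ ∘L ContinuousLinearMap.mul 𝕜 A a := by
    ext b : 1
    exact (M.dual.lact_mul a b φ).symm
  rw [lactBidual, ContinuousLinearMap.comp_apply, ← bidualEval_dual_lact_comp, hG]
  exact h.bidualEval_comp_mul_left a _

theorem dual_ract_ractBidual (h : IsMixedIdentity Λ) (a : A) (φ : StrongDual 𝕜 X) :
    M.dual.ract a (ractBidual Λ M φ) = M.dual.ract a φ := by
  have hG : M.dual.ract a ∘L M.dual.ract.flip φ =
      M.dual.ract.flip φ ∘L (ContinuousLinearMap.mul 𝕜 A).flip a := by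
    ext b : 1
    exact (M.dual.ract_mul b a φ).symm
  rw [ractBidual, ContinuousLinearMap.comp_apply, ← bidualEval_dual_ract_comp, hG]
  exact h.bidualEval_comp_mul_right a _

theorem isBimoduleHom_lactBidual (h : IsMixedIdentity Λ) :
    IsBimoduleHom M.dual M.dual (lactBidual Λ M) where
  map_lact a φ := by rw [h.lactBidual_dual_lact, h.dual_lact_lactBidual]
  map_ract a φ := by
    have hG : M.dual.lact.flip (M.dual.ract a φ) = M.dual.ract a ∘L M.dual.lact.flip φ := by
      ext b : 1
      exact M.dual.lact_ract b a φ
    exact congrArg (bidualEval Λ) hG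

theorem isBimoduleHom_ractBidual (h : IsMixedIdentity Λ) :
    IsBimoduleHom M.dual M.dual (ractBidual Λ M) where
  map_lact a φ := by
    have hG : M.dual.ract.flip (M.dual.lact a φ) = M.dual.lact a ∘L M.dual.ract.flip φ := by
      ext b : 1
      exact (M.dual.lact_ract a b φ).symm
    exact congrArg (bidualEval Λ) hG
  map_ract a φ := by rw [h.ractBidual_dual_ract, h.dual_ract_ractBidual]

theorem isBimoduleHom_bidualCompression (h : IsMixedIdentity Λ) :
    IsBimoduleHom M.dual M.dual (bidualCompression Λ M) :=
  h.isBimoduleHom_ractBidual.comp h.isBimoduleHom_lactBidual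

theorem bidualCompression_apply (h : IsMixedIdentity Λ) (φ : StrongDual 𝕜 X) {x : X}
    (hx : x ∈ M.productSet) : bidualCompression Λ M φ x = φ x := by
  obtain ⟨a, b, x, rfl⟩ := hx
  calc bidualCompression Λ M φ (M.ract b (M.lact a x))
      = M.dual.ract a (ractBidual Λ M (M.dual.lact b (lactBidual Λ M φ))) x := by
        rw [h.isBimoduleHom_ractBidual.map_lact]
        rfl
    _ = φ (M.ract b (M.lact a x)) := by
        rw [h.dual_ract_ractBidual, h.dual_lact_lactBidual]
        rfl

end IsMixedIdentity

end MixedIdentity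

section FinTuple

variable {A : Type*} {n : ℕ}

theorem tail_snoc (v : Fin (n + 1) → A) (e : A) :
    Fin.tail (Fin.snoc v e : Fin (n + 2) → A) = Fin.snoc (Fin.tail v) e := by
  ext i
  cases i using Fin.lastCases <;>
    simp [Fin.tail, ← Fin.castSucc_succ, Fin.succ_last, Fin.snoc_castSucc (α := fun _ => A)]

theorem init_cons (v : Fin (n + 1) → A) (e : A) :
    Fin.init (Fin.cons e v : Fin (n + 2) → A) = Fin.cons e (Fin.init v) := by
  ext i
  cases i using Fin.cases <;> rfl

variable [Mul A]

theorem contractNth_snoc_castSucc (k : Fin n) (v : Fin (n + 1) → A) (e : A) :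
    k.castSucc.castSucc.contractNth (· * ·) (Fin.snoc v e : Fin (n + 2) → A) =
      Fin.snoc (k.castSucc.contractNth (· * ·) v) e := by
  ext i
  cases i using Fin.lastCases with
  | last => simp [Fin.contractNth, k.is_lt.not_gt, k.is_lt.ne']
  | cast i => simp only [Fin.contractNth, Fin.succ_castSucc, Fin.snoc_castSucc (α := fun _ => A),
      Fin.val_castSucc]

theorem contractNth_snoc_last (v : Fin (n + 1) → A) (e : A) :
    (Fin.last n).castSucc.contractNth (· * ·) (Fin.snoc v e : Fin (n + 2) → A) =
      Fin.snoc (Fin.init v) (v (Fin.last n) * e) := by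
  ext i
  cases i using Fin.lastCases <;> simp [Fin.contractNth, Fin.init]

theorem contractNth_cons_succ (k : Fin n) (v : Fin (n + 1) → A) (e : A) :
    k.succ.castSucc.contractNth (· * ·) (Fin.cons e v : Fin (n + 2) → A) =
      Fin.cons e (k.castSucc.contractNth (· * ·) v) := by
  ext i
  cases i using Fin.cases <;> simp [Fin.contractNth]

theorem contractNth_cons_zero (v : Fin (n + 1) → A) (e : A) :
    (0 : Fin (n + 1)).castSucc.contractNth (· * ·) (Fin.cons e v : Fin (n + 2) → A) =
      Fin.cons (e * v 0) (Fin.tail v) := by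
  ext i
  cases i using Fin.cases <;> simp [Fin.contractNth, Fin.tail]

end FinTuple

section Coboundaries

variable {𝕜 A X : Type*} [RCLike 𝕜] [NonUnitalNormedRing A] [NormedSpace 𝕜 A]
  [NormedAddCommGroup X] [NormedSpace 𝕜 X] {Λ : StrongDual 𝕜 (StrongDual 𝕜 A)} {m : ℕ}

/-- The cochain `v ↦ ⟨T(v, ·), Λ⟩`: the last argument is extended to `A**` and evaluated at `Λ`. -/
def rightSlice (Λ : StrongDual 𝕜 (StrongDual 𝕜 A)) (T : A [×(m + 1)]→L[𝕜] StrongDual 𝕜 X) :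
    A [×m]→L[𝕜] StrongDual 𝕜 X :=
  (bidualEval Λ).compContinuousMultilinearMap T.curryRight

/-- The cochain `v ↦ ⟨T(·, v), Λ⟩`: the first argument is extended to `A**` and evaluated at `Λ`. -/
def leftSlice (Λ : StrongDual 𝕜 (StrongDual 𝕜 A)) (T : A [×(m + 1)]→L[𝕜] StrongDual 𝕜 X) :
    A [×m]→L[𝕜] StrongDual 𝕜 X :=
  (bidualEval Λ).compContinuousMultilinearMap T.curryLeft.flipMultilinear

theorem rightSlice_apply (T : A [×(m + 1)]→L[𝕜] StrongDual 𝕜 X) (v : Fin m → A) :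
    rightSlice Λ T v = bidualEval Λ (T.curryRight v) := rfl

theorem leftSlice_apply (T : A [×(m + 1)]→L[𝕜] StrongDual 𝕜 X) (v : Fin m → A) :
    leftSlice Λ T v = bidualEval Λ (T.curryLeft.flipMultilinear v) := rfl

variable [IsScalarTower 𝕜 A A] [SMulCommClass 𝕜 A A]

theorem coboundary_snoc (M : BanachBimodule 𝕜 A X) (T : A [×(m + 1)]→L[𝕜] X)
    (v : Fin (m + 1) → A) (e : A) :
    M.coboundary (m + 1) T (Fin.snoc v e) = M.lact (v 0) (T (Fin.snoc (Fin.tail v) e))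
      + ∑ k : Fin m, (-1 : 𝕜) ^ ((k : ℕ) + 1) • T (Fin.snoc (k.castSucc.contractNth (· * ·) v) e)
      + (-1 : 𝕜) ^ (m + 1) • T (Fin.snoc (Fin.init v) (v (Fin.last m) * e))
      + (-1 : 𝕜) ^ (m + 2) • M.ract e (T v) := by
  rw [coboundary_apply, Fin.sum_univ_castSucc, ← add_assoc]
  simp only [tail_snoc, contractNth_snoc_castSucc, contractNth_snoc_last, Fin.val_castSucc,
    Fin.val_last, Fin.snoc_apply_zero, Fin.snoc_last, Fin.init_snoc]

theorem coboundary_cons (M : BanachBimodule 𝕜 A X) (T : A [×(m + 1)]→L[𝕜] X)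
    (v : Fin (m + 1) → A) (e : A) :
    M.coboundary (m + 1) T (Fin.cons e v) = M.lact e (T v)
      - T (Fin.cons (e * v 0) (Fin.tail v))
      - ∑ k : Fin m, (-1 : 𝕜) ^ ((k : ℕ) + 1) • T (Fin.cons e (k.castSucc.contractNth (· * ·) v))
      - (-1 : 𝕜) ^ (m + 1) • M.ract (v (Fin.last m)) (T (Fin.cons e (Fin.init v))) := by
  rw [coboundary_apply, Fin.sum_univ_succ]
  simp only [init_cons, contractNth_cons_succ, contractNth_cons_zero, Fin.val_zero, Fin.val_succ,
    ← Fin.succ_last, Fin.cons_zero, Fin.cons_succ, Fin.tail_cons, pow_succ _ (_ + 1), mul_neg_one,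
    neg_smul, Finset.sum_neg_distrib, zero_add, pow_one, one_smul]
  abel

namespace IsMixedIdentity

variable {M : BanachBimodule 𝕜 A X} {T : A [×(m + 1)]→L[𝕜] StrongDual 𝕜 X}

theorem coboundary_rightSlice (h : IsMixedIdentity Λ) (hT : T ∈ M.dual.cocycles (m + 1))
    (hzero : ∀ a v, M.dual.ract a (T v) = 0) :
    M.dual.coboundary m (rightSlice Λ T) = (-1 : 𝕜) ^ m • T := by
  ext1 v
  have hcocycle : M.dual.lact (v 0) ∘L T.curryRight (Fin.tail v)
      + ∑ k : Fin m, (-1 : 𝕜) ^ ((k : ℕ) + 1) •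
          T.curryRight (k.castSucc.contractNth (· * ·) v)
      = (-1 : 𝕜) ^ m •
          T.curryRight (Fin.init v) ∘L ContinuousLinearMap.mul 𝕜 A (v (Fin.last m)) := by
    ext e : 1
    have hTe := DFunLike.congr_fun (LinearMap.mem_ker.1 hT) (Fin.snoc v e)
    rw [coboundary_snoc, hzero, smul_zero, add_zero, pow_succ, mul_neg_one, neg_smul,
      ← sub_eq_add_neg] at hTe
    simpa [sub_eq_zero] using hTe
  have hract : M.dual.ract (v (Fin.last m)) ∘L T.curryRight (Fin.init v) = 0 := by
    ext e : 1
    exact hzero _ _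
  have heval := congrArg (bidualEval Λ) hcocycle
  simp only [map_add, map_sum, map_smul, bidualEval_dual_lact_comp,
    h.bidualEval_comp_mul_left] at heval
  rw [coboundary_apply]
  simp only [rightSlice_apply, ← bidualEval_dual_ract_comp, hract, map_zero, smul_zero, add_zero]
  rw [heval]
  simp

theorem coboundary_leftSlice (h : IsMixedIdentity Λ) (hT : T ∈ M.dual.cocycles (m + 1))
    (hzero : ∀ a v, M.dual.lact a (T v) = 0) :
    M.dual.coboundary m (leftSlice Λ T) = -T := by
  ext1 v
  have hcocycle : ∑ k : Fin m, (-1 : 𝕜) ^ ((k : ℕ) + 1) •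
          T.curryLeft.flipMultilinear (k.castSucc.contractNth (· * ·) v)
      + (-1 : 𝕜) ^ (m + 1) • M.dual.ract (v (Fin.last m)) ∘L
          T.curryLeft.flipMultilinear (Fin.init v)
      = -(T.curryLeft.flipMultilinear (Fin.tail v) ∘L
          (ContinuousLinearMap.mul 𝕜 A).flip (v 0)) := by
    ext e : 1
    have hTe := DFunLike.congr_fun (LinearMap.mem_ker.1 hT) (Fin.cons e v)
    rw [coboundary_cons, hzero, zero_sub, sub_sub, zero_apply, sub_eq_zero] at hTe
    simpa using hTe.symm
  have hlact : M.dual.lact (v 0) ∘L T.curryLeft.flipMultilinear (Fin.tail v) = 0 := by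
    ext e : 1
    exact hzero _ _
  have heval := congrArg (bidualEval Λ) hcocycle
  rw [map_neg (bidualEval Λ), h.bidualEval_comp_mul_right] at heval
  simp only [map_add, map_sum, map_smul, bidualEval_dual_ract_comp] at heval
  rw [coboundary_apply]
  simp only [leftSlice_apply, ← bidualEval_dual_lact_comp, hlact, map_zero, zero_add]
  rw [heval]
  simp

theorem sub_cochainMap_ractBidual_mem (h : IsMixedIdentity Λ)
    (hT : T ∈ M.dual.cocycles (m + 1)) :
    T - cochainMap A (ractBidual Λ M) (m + 1) T ∈ M.dual.coboundaries (m + 1) := by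
  have hS := sub_mem hT (h.isBimoduleHom_ractBidual.cochainMap_mem_cocycles _ T hT)
  have hδ := h.coboundary_rightSlice hS fun a v => by
    rw [sub_apply, map_sub, cochainMap_apply, h.dual_ract_ractBidual, sub_self]
  refine ⟨(-1 : 𝕜) ^ m • rightSlice Λ (T - cochainMap A (ractBidual Λ M) (m + 1) T), ?_⟩
  rw [map_smul, hδ, smul_smul, ← mul_pow, neg_one_mul, neg_neg, one_pow, one_smul]

theorem sub_cochainMap_lactBidual_mem (h : IsMixedIdentity Λ)
    (hT : T ∈ M.dual.cocycles (m + 1)) :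
    T - cochainMap A (lactBidual Λ M) (m + 1) T ∈ M.dual.coboundaries (m + 1) := by
  have hS := sub_mem hT (h.isBimoduleHom_lactBidual.cochainMap_mem_cocycles _ T hT)
  have hδ := h.coboundary_leftSlice hS fun a v => by
    rw [sub_apply, map_sub, cochainMap_apply, h.dual_lact_lactBidual, sub_self]
  refine ⟨-leftSlice Λ (T - cochainMap A (lactBidual Λ M) (m + 1) T), ?_⟩
  rw [map_neg, hδ, neg_neg]

theorem sub_cochainMap_bidualCompression_mem (h : IsMixedIdentity Λ)
    (hT : T ∈ M.dual.cocycles (m + 1)) :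
    T - cochainMap A (bidualCompression Λ M) (m + 1) T ∈ M.dual.coboundaries (m + 1) := by
  have hl := h.sub_cochainMap_lactBidual_mem hT
  have hlT := h.isBimoduleHom_lactBidual.cochainMap_mem_cocycles _ T hT
  exact sub_add_sub_cancel T _ _ ▸ add_mem hl (h.sub_cochainMap_ractBidual_mem hlT)

end IsMixedIdentity

end Coboundaries

section RestrictDual

variable {𝕜 A X : Type*} [RCLike 𝕜] [NonUnitalNormedRing A] [NormedSpace 𝕜 A]
  [NormedAddCommGroup X] [NormedSpace 𝕜 X]

theorem restrictDual_surjective (Y : Submodule 𝕜 X) : Function.Surjective (restrictDual Y) :=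
  fun ψ => (exists_extension_norm_eq Y ψ).imp fun _ hφ => ContinuousLinearMap.ext hφ.1

theorem ker_restrictDual (Y : Submodule 𝕜 X) : (restrictDual Y).ker = annihilator Y := by
  ext φ
  exact ⟨fun hφ y hy => DFunLike.congr_fun (LinearMap.mem_ker.1 hφ) ⟨y, hy⟩,
    fun hφ => LinearMap.mem_ker.2 (ContinuousLinearMap.ext fun y => hφ y y.2)⟩

theorem closedComplemented_annihilator {Y : Submodule 𝕜 X}
    {s : StrongDual 𝕜 Y →L[𝕜] StrongDual 𝕜 X} (hs : restrictDual Y ∘L s = .id 𝕜 _) :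
    (annihilator Y).ClosedComplemented := by
  rw [← ker_restrictDual]
  exact (restrictDual Y).closedComplemented_ker_of_rightInverse s (DFunLike.congr_fun hs)

variable [IsScalarTower 𝕜 A A] [SMulCommClass 𝕜 A A] {Λ : StrongDual 𝕜 (StrongDual 𝕜 A)}
  {M : BanachBimodule 𝕜 A X}

theorem IsMixedIdentity.exists_section_restrictDual (h : IsMixedIdentity Λ) (X₁ : M.SubBimodule)
    (hX₁ : (X₁.toSubmodule : Set X) = M.productSet) :
    ∃ s : StrongDual 𝕜 X₁.toSubmodule →L[𝕜] StrongDual 𝕜 X,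
      IsBimoduleHom X₁.toBanachBimodule.dual M.dual s ∧
      restrictDual X₁.toSubmodule ∘L s = .id 𝕜 _ ∧
      s ∘L restrictDual X₁.toSubmodule = bidualCompression Λ M := by
  have hsurj := restrictDual_surjective X₁.toSubmodule
  have hker : (restrictDual X₁.toSubmodule).ker ≤ (bidualCompression Λ M).ker := fun φ hφ => by
    rw [ker_restrictDual] at hφ
    exact LinearMap.mem_ker.2 (bidualCompression_apply_eq_zero Λ fun x hx => hφ x (hX₁.ge hx))
  obtain ⟨s, hs⟩ := exists_comp_eq_of_ker_le hsurj hker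
  refine ⟨s, .of_comp_surjective (hs ▸ h.isBimoduleHom_bidualCompression)
    X₁.isBimoduleHom_restrictDual hsurj, ?_, hs⟩
  ext ψ x
  obtain ⟨φ, rfl⟩ := hsurj ψ
  exact (DFunLike.congr_fun (DFunLike.congr_fun hs φ) (x : X)).trans
    (h.bidualCompression_apply φ (hX₁.le x.2))

end RestrictDual

section Cohomology

variable {𝕜 A X Y : Type*} [RCLike 𝕜] [NonUnitalNormedRing A] [NormedSpace 𝕜 A]
  [IsScalarTower 𝕜 A A] [SMulCommClass 𝕜 A A] [NormedAddCommGroup X] [NormedSpace 𝕜 X]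
  [NormedAddCommGroup Y] [NormedSpace 𝕜 Y]

theorem ApproxCohomology.leftInverse_map {M : BanachBimodule 𝕜 A X} {N : BanachBimodule 𝕜 A Y}
    {f : X →L[𝕜] Y} {g : Y →L[𝕜] X} (hf : IsBimoduleHom M N f) (hg : IsBimoduleHom N M g) {n : ℕ}
    (hgf : ∀ T ∈ M.cocycles n, T - cochainMap A (g ∘L f) n T ∈ M.coboundaries n) :
    Function.LeftInverse (map hg n) (map hf n) := by
  intro z
  obtain ⟨⟨T, hT⟩, rfl⟩ := Submodule.Quotient.mk_surjective _ z
  refine ((Submodule.Quotient.eq _).2 ?_).symm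
  exact @subset_closure _ (strongTopology 𝕜 A X n) _ _ (hgf T hT)

theorem IsMixedIdentity.bijective_map_restrictDual {Λ : StrongDual 𝕜 (StrongDual 𝕜 A)}
    (h : IsMixedIdentity Λ) {M : BanachBimodule 𝕜 A X} (X₁ : M.SubBimodule)
    (hX₁ : (X₁.toSubmodule : Set X) = M.productSet) {n : ℕ} (hn : 1 ≤ n) :
    Function.Bijective (ApproxCohomology.map X₁.isBimoduleHom_restrictDual n) := by
  obtain ⟨m, rfl⟩ := Nat.exists_eq_add_of_le' hn
  obtain ⟨s, hs, hrs, hsr⟩ := h.exists_section_restrictDual X₁ hX₁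
  have hleft := ApproxCohomology.leftInverse_map (n := m + 1) X₁.isBimoduleHom_restrictDual hs
    fun T hT => hsr ▸ h.sub_cochainMap_bidualCompression_mem hT
  have hright := ApproxCohomology.leftInverse_map (n := m + 1) hs X₁.isBimoduleHom_restrictDual
    fun T _ => by
      have hid : cochainMap A (restrictDual X₁.toSubmodule ∘L s) (m + 1) T = T := by
        rw [hrs]
        rfl
      rw [hid, sub_self]
      exact zero_mem _
  exact ⟨hleft.injective, hright.surjective⟩

end Cohomology

end BanachBimodule

end

theorem mainTheorem5 {𝕜 A X : Type*} [RCLike 𝕜]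
    [NonUnitalNormedRing A] [NormedSpace 𝕜 A] [IsScalarTower 𝕜 A A] [SMulCommClass 𝕜 A A]
    [CompleteSpace A] (hA : HasBoundedApproximateIdentity A)
    [NormedAddCommGroup X] [NormedSpace 𝕜 X] [CompleteSpace X] (M : BanachBimodule 𝕜 A X) :
    ∃ X₁ : M.SubBimodule,
      (X₁.toSubmodule : Set X) = M.productSet ∧
      IsClosed (X₁.toSubmodule : Set X) ∧
      X₁.toBanachBimodule.IsNeoUnital ∧
      (BanachBimodule.annihilator X₁.toSubmodule).ClosedComplemented ∧
      ∀ n : ℕ, 1 ≤ n →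
        ∃ e : M.dual.ApproxCohomology n ≃ₗ[𝕜] X₁.toBanachBimodule.dual.ApproxCohomology n,
          (e : M.dual.ApproxCohomology n →ₗ[𝕜] X₁.toBanachBimodule.dual.ApproxCohomology n) =
            BanachBimodule.ApproxCohomology.map X₁.isBimoduleHom_restrictDual n := by
  obtain ⟨l, hl, K, hK⟩ := hA
  obtain ⟨Λ, hΛ⟩ := BanachBimodule.exists_isMixedIdentity 𝕜 hl hK
  have hX₁ := M.coe_essentialPart hl hK
  obtain ⟨s, -, hs, -⟩ := hΛ.exists_section_restrictDual _ hX₁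
  exact ⟨M.essentialPart hl, hX₁, M.isClosed_essentialPart hl hK, M.isNeoUnital_essentialPart hl hK,
    BanachBimodule.closedComplemented_annihilator hs, fun n hn =>
      ⟨.ofBijective _ (hΛ.bijective_map_restrictDual _ hX₁ hn), rfl⟩⟩
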